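/- Let $G=\mathbb Z/12\times\mathbb Z/6$ and let $x,y$ be the $72\times72$ binary permutation matrices indexed by $G$ with $x_{g,h}=1$ iff $h=g+(1,0)$ and $y_{g,h}=1$ iff $h=g+(0,1)$. The $[[144,12,12]]$ gross code is the CSS code on 144 data qubits with parity-check matrices $H_X=[A\mid B]$ and $H_Z=[B^{\mathsf T}\mid A^{\mathsf T}]$ over $\mathbb F_2$, where $A=x^3+y+y^2$ and $B=y^3+x+x^2$; its checks are the 144 rows of $H_X$ and $H_Z$. A single-ancilla syndrome extraction circuit (SEC) uses one dedicated ancilla qubit per check. In every round, the ancilla of an $X$-check (resp. $Z$-check) is prepared in $|+\rangle$ (resp. $|0\rangle$), takes part in one CNOT with each data qubit in the support of the check, controlled on the ancilla (resp. on the data qubit), and is then measured in the $X$-basis (resp. $Z$-basis). The SEC is specified by the time steps of all these operations within a round and by the starting times of the rounds, such that no qubit takes part in two operations in the same time step and each ancilla is measured before it is prepared again; successive rounds may otherwise overlap in time. The SEC is non-interleaved if, for all rounds $r,r'$ (equal or not), either every $X$-type CNOT of round $r$ precedes every $Z$-type CNOT of round $r'$ on the same data qubit (for all data qubits), or every $Z$-type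 CNOT of round $r'$ precedes every $X$-type CNOT of round $r$ on the same data qubit (for all data qubits). In the $m$-round $Z$-basis (resp. $X$-basis) memory experiment all data qubits are prepared in $|0\rangle$ (resp. $|+\rangle$), $m$ rounds of the SEC are run, and all data qubits are measured in the $Z$-basis (resp. $X$-basis). Error mechanisms are the individual failures under standard circuit noise: a non-identity one-qubit Pauli after an idle step of a qubit, a non-identity two-qubit Pauli after a CNOT, a preparation of the orthogonal state, or a flipped measurement outcome. The detectors are the parities of the outcomes of a check in two consecutive rounds and, for the checks of the type of the experiment, also the first-round outcome and the parity of the last-round outcome with the value of the check reconstructed from the final data measurements. The logical observables are the logical operators of the type of the experiment, evaluated on the final data measurements. The circuit distance $d_{\mathrm{circ}}$ is the minimum, over the two experiments, of the least number of error mechanisms that together flip no detector but flip at least one logical observable. **Proposition (Gross circuits).** For every non-interleaved single-ancilla SEC for the gross code and every number $m\ge 1$ of rounds in the memory experiments, $$d_{\mathrm{circ}}\le 11 .$$ -/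

import Mathlib

namespace SyndromeExtraction

/-- The two Pauli bases. Also used as the type (`X` or `Z`) of a check. -/
inductive Basis
  | X
  | Z
  deriving DecidableEq

instance : Fintype Basis where
  elems := {.X, .Z}
  complete b := by cases b <;> simp

/-- The opposite basis. -/
def Basis.dual : Basis → Basis
  | .X => .Z
  | .Z => .X

section Circuits

/-- A Pauli operator modulo phase on the qubits `V`: `P .X v = 1` when `P` acts on `v` with an
`X` factor, and `P .Z v = 1` when it acts with a `Z` factor (both, for `Y`). -/
abbrev Pauli (V : Type*) := Basis → V → ZMod 2

/-- Circuit operations: preparation of the `+1` eigenstate of a basis (`Z` gives `|0⟩` and `X`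
gives `|+⟩`), measurement in a basis, CNOT with given control and target, and idling. -/
inductive Gate (V : Type*)
  | prep (b : Basis) (v : V)
  | meas (b : Basis) (v : V)
  | cnot (control target : V)
  | idle (v : V)

/-- The qubits on which an operation acts. -/
def Gate.qubits {V : Type*} : Gate V → Set V
  | .prep _ v => {v}
  | .meas _ v => {v}
  | .cnot c t => {c, t}
  | .idle v => {v}

/-- A circuit assigns to each time step the operations carried out in that step. -/
abbrev Circuit (V : Type*) := ℕ → Set (Gate V)

open Classical in
/-- Propagation of a Pauli operator through one time step: preparations erase it, a CNOT copies
`X` from control to target and `Z` from target to control. -/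
noncomputable def propagate {V : Type*} [Fintype V] (L : Set (Gate V)) (P : Pauli V) : Pauli V
  | .X, v => if ∃ b, Gate.prep b v ∈ L then 0
      else P .X v + ∑ c, if Gate.cnot c v ∈ L then P .X c else 0
  | .Z, v => if ∃ b, Gate.prep b v ∈ L then 0
      else P .Z v + ∑ t, if Gate.cnot v t ∈ L then P .Z t else 0

/-- Circuit noise: the Pauli errors `P` that can follow a failing operation. An idle operation
is followed by a non-identity Pauli, a CNOT by a non-identity two-qubit Pauli, and a preparation
yields the orthogonal state of its basis. A failing measurement leaves no Pauli error: it flips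
its outcome, see `Mechanism.outcomeFlip`. -/
def Gate.IsFault {V : Type*} : Gate V → Pauli V → Prop
  | .prep b v, P => P b = 0 ∧ Function.support (P b.dual) = {v}
  | .meas _ _, P => P = 0
  | .cnot c t, P => P ≠ 0 ∧ ∀ b, Function.support (P b) ⊆ {c, t}
  | .idle v, P => P ≠ 0 ∧ ∀ b, Function.support (P b) ⊆ {v}

/-- An error mechanism of a circuit: one way in which one of its operations can fail. -/
structure Mechanism {V : Type*} (C : Circuit V) where
  time : ℕ
  gate : Gate V
  mem : gate ∈ C time
  error : Pauli V
  isFault : gate.IsFault error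

/-- The Pauli error present just before time step `t`, when only the mechanism `e` occurs. -/
noncomputable def Mechanism.frame {V : Type*} [Fintype V] {C : Circuit V} (e : Mechanism C) :
    ℕ → Pauli V
  | 0 => 0
  | t + 1 => propagate (C t) (e.frame t) + if t = e.time then e.error else 0

open Classical in
/-- Whether `e` flips the outcome of a measurement of `v` in the basis `b` at time `t`: either a
Pauli error anticommuting with the measured one is present, or that measurement itself fails. -/
noncomputable def Mechanism.outcomeFlip {V : Type*} [Fintype V] {C : Circuit V}
    (e : Mechanism C) (t : ℕ) (b : Basis) (v : V) : ZMod 2 :=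
  e.frame t b.dual v + if e.time = t ∧ e.gate = Gate.meas b v then 1 else 0

end Circuits

/-- A CSS code on the data qubits `Q`, given by its parity-check matrices `H .X` and `H .Z`. -/
structure CSSCode (R : Basis → Type*) (Q : Type*) [Fintype Q] where
  H : (b : Basis) → Matrix (R b) Q (ZMod 2)
  comm : H .X * (H .Z).transpose = 0

section Experiments

variable {R : Basis → Type*} {Q : Type*} [Fintype Q]

/-- The checks of the code: the rows of both matrices. -/
abbrev CSSCode.Check (_K : CSSCode R Q) := Σ b : Basis, R b

/-- The data qubits in the support of a check. -/
def CSSCode.support (K : CSSCode R Q) (c : K.Check) : Set Q := {q | K.H c.1 c.2 q = 1}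

/-- The qubits of a single-ancilla circuit: the data qubits and one ancilla for each check. -/
abbrev CSSCode.Qubit (K : CSSCode R Q) := Q ⊕ K.Check

/-- The logical operators of type `b`: supports commuting with all checks of the other type and
not generated by the checks of type `b`. -/
def CSSCode.logicals (K : CSSCode R Q) (b : Basis) : Set (Q → ZMod 2) :=
  {v | (K.H b.dual).mulVec v = 0 ∧ v ∉ Submodule.span (ZMod 2) (Set.range (K.H b))}

/-- A single-ancilla syndrome extraction circuit: for each check, the time steps (relative to the
start of a round) of the ancilla preparation, of the CNOT with each data qubit of the support, and
of the ancilla measurement; and the starting time of each round. Successive rounds may overlap in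
time. A qubit takes part in at most one operation at a time. -/
structure SEC (K : CSSCode R Q) where
  prep : K.Check → ℕ
  /-- Only the values at data qubits in the support of the check matter. -/
  cnot : K.Check → Q → ℕ
  meas : K.Check → ℕ
  start : ℕ → ℕ
  prep_lt_meas : ∀ c, prep c < meas c
  prep_lt_cnot : ∀ c, ∀ q ∈ K.support c, prep c < cnot c q
  cnot_lt_meas : ∀ c, ∀ q ∈ K.support c, cnot c q < meas c
  /-- An ancilla is measured before it is prepared for the next round. -/
  meas_lt_prep : ∀ c r, start r + meas c < start (r + 1) + prep c
  /-- An ancilla takes part in one CNOT at a time. -/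
  ancilla_inj : ∀ c, Set.InjOn (cnot c) (K.support c)
  /-- A data qubit takes part in one CNOT at a time. -/
  data_inj : ∀ c c' q r r', q ∈ K.support c → q ∈ K.support c' →
    start r + cnot c q = start r' + cnot c' q → c = c' ∧ r = r'

namespace SEC

variable {K : CSSCode R Q} (S : SEC K)

/-- The time step of the CNOT between the ancilla of `c` and the data qubit `q` in round `r`. -/
def cnotTime (c : K.Check) (q : Q) (r : ℕ) : ℕ := S.start r + S.cnot c q

/-- All `b`-type CNOTs of round `r` precede all overlapping CNOTs of the opposite type of round
`r'`, where CNOTs overlap when they act on a common data qubit. -/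
def Precedes (b : Basis) (r r' : ℕ) : Prop :=
  ∀ (i : R b) (j : R b.dual) (q : Q), q ∈ K.support ⟨b, i⟩ → q ∈ K.support ⟨b.dual, j⟩ →
    S.cnotTime ⟨b, i⟩ q r < S.cnotTime ⟨b.dual, j⟩ q r'

/-- Non-interleaved circuits: either all `X`-type CNOTs precede all overlapping `Z`-type CNOTs,
or the other way round. As rounds are repeated and may be staggered, this is required both of the
`X`-part and the `Z`-part of one round and of those of two different rounds. -/
def NonInterleaved : Prop :=
  ∀ r r' : ℕ, S.Precedes .X r r' ∨ S.Precedes .Z r' r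

section Memory

variable [∀ b, Fintype (R b)]

/-- The time step of the final data measurements of the `m`-round memory experiment, after all
other operations. (The circuit of the rounds is delayed by one step to prepare the data.) -/
def finish (m : ℕ) : ℕ :=
  ((Finset.range m).sup fun r => Finset.univ.sup fun c => S.start r + S.meas c) + 2

/-- The operations, other than idling, of the `b`-basis memory experiment with `m` rounds. -/
inductive Active (b : Basis) (m : ℕ) : ℕ → Gate K.Qubit → Prop
  | dataPrep (q : Q) : Active b m 0 (.prep b (.inl q))
  | ancillaPrep (c : K.Check) (r : ℕ) (hr : r < m) :
      Active b m (S.start r + S.prep c + 1) (.prep c.1 (.inr c))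
  | cnotX (i : R .X) (q : Q) (r : ℕ) (hr : r < m) (hq : q ∈ K.support ⟨.X, i⟩) :
      Active b m (S.cnotTime ⟨.X, i⟩ q r + 1) (.cnot (.inr ⟨.X, i⟩) (.inl q))
  | cnotZ (j : R .Z) (q : Q) (r : ℕ) (hr : r < m) (hq : q ∈ K.support ⟨.Z, j⟩) :
      Active b m (S.cnotTime ⟨.Z, j⟩ q r + 1) (.cnot (.inl q) (.inr ⟨.Z, j⟩))
  | ancillaMeas (c : K.Check) (r : ℕ) (hr : r < m) :
      Active b m (S.start r + S.meas c + 1) (.meas c.1 (.inr c))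
  | dataMeas (q : Q) : Active b m (S.finish m) (.meas b (.inl q))

/-- The `b`-basis memory experiment with `m` rounds: the data qubits are prepared in `|0⟩`
(or `|+⟩`), `m` rounds of the circuit are run, and the data qubits are measured in the same basis.
A qubit without an operation in a time step idles. -/
def memoryCircuit (b : Basis) (m : ℕ) : Circuit K.Qubit := fun t =>
  {g | S.Active b m t g} ∪
  {g | ∃ v, g = .idle v ∧ t ≤ S.finish m ∧ ∀ g', S.Active b m t g' → v ∉ g'.qubits}

variable {S} {b : Basis} {m : ℕ}

/-- Whether `e` flips the final measurement outcome of the data qubit `q`. -/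
noncomputable def dataFlip (e : Mechanism (S.memoryCircuit b m)) (q : Q) : ZMod 2 :=
  e.outcomeFlip (S.finish m) b (.inl q)

/-- Whether `e` flips the successive values of the check `c`: a reference value, which is never
flipped, then (in position `k + 1`) the ancilla outcomes of the rounds `k < m`, and at last the
value reconstructed from the final data measurements. -/
noncomputable def syndromeFlip (e : Mechanism (S.memoryCircuit b m)) (c : K.Check) : ℕ → ZMod 2
  | 0 => 0
  | k + 1 => if k < m then e.outcomeFlip (S.start k + S.meas c + 1) c.1 (.inr c)
      else ∑ q, K.H c.1 c.2 q * dataFlip e q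

/-- The detectors of the `b`-basis memory experiment, which compare the values of a check in
positions `k` and `k + 1`. The checks of type `b` have a deterministic value at the start and can be
reconstructed at the end; for those of the other type, only consecutive rounds can be compared. -/
def IsDetector (b : Basis) (m : ℕ) (c : K.Check) (k : ℕ) : Prop :=
  if c.1 = b then k ≤ m else 1 ≤ k ∧ k < m

/-- Whether `e` flips the detector `(c, k)`. -/
noncomputable def detectorFlip (e : Mechanism (S.memoryCircuit b m)) (c : K.Check) (k : ℕ) :
    ZMod 2 :=
  syndromeFlip e c (k + 1) + syndromeFlip e c k

/-- Whether `e` flips the logical observable `v`, read off from the final data measurements. -/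
noncomputable def observableFlip (e : Mechanism (S.memoryCircuit b m)) (v : Q → ZMod 2) : ZMod 2 :=
  ∑ q, v q * dataFlip e q

/-- An error configuration that flips no detector but flips at least one logical observable.
(Once no detector is flipped, some logical operator is flipped if and only if a member of any
given basis of logical operators is.) -/
def IsCircuitLogical (E : Finset (Mechanism (S.memoryCircuit b m))) : Prop :=
  (∀ (c : K.Check) (k : ℕ), IsDetector b m c k → ∑ e ∈ E, detectorFlip e c k = 0) ∧
  ∃ v ∈ K.logicals b, ∑ e ∈ E, observableFlip e v ≠ 0

variable (S)

/-- The minimum number of error mechanisms in the `b`-basis memory experiment with `m` rounds that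
flip no detector but flip at least one logical observable (`⊤` if there are none). -/
noncomputable def basisDistance (b : Basis) (m : ℕ) : ℕ∞ :=
  ⨅ (E : Finset (Mechanism (S.memoryCircuit b m))) (_ : IsCircuitLogical E), (E.card : ℕ∞)

/-- The circuit distance, for memory experiments with `m` rounds. -/
noncomputable def circuitDistance (m : ℕ) : ℕ∞ :=
  min (S.basisDistance .X m) (S.basisDistance .Z m)

end Memory

end SEC

end Experiments

section GrossCode

/-- The matrix of `∑ a ∈ s, x ^ a.1 * y ^ a.2` where `x = S₁₂ ⊗ I₆` and `y = I₁₂ ⊗ S₆` are the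
cyclic shifts (`S` has a `1` in row `i` and column `i + 1`). -/
def shiftMatrix (s : Finset (ZMod 12 × ZMod 6)) :
    Matrix (ZMod 12 × ZMod 6) (ZMod 12 × ZMod 6) (ZMod 2) :=
  Matrix.of fun g h => if h - g ∈ s then 1 else 0

theorem shiftMatrix_mul_comm (s t : Finset (ZMod 12 × ZMod 6)) :
    shiftMatrix s * shiftMatrix t = shiftMatrix t * shiftMatrix s := by
  have key : ∀ u : Finset (ZMod 12 × ZMod 6),
      shiftMatrix u = Matrix.circulant fun d => if -d ∈ u then (1 : ZMod 2) else 0 := by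
    intro u
    ext g h
    simp [shiftMatrix, Matrix.circulant_apply]
  rw [key s, key t, Matrix.circulant_mul_comm]

/-- `A = x ^ 3 + y + y ^ 2`. -/
def grossA : Matrix (ZMod 12 × ZMod 6) (ZMod 12 × ZMod 6) (ZMod 2) :=
  shiftMatrix {(3, 0), (0, 1), (0, 2)}

/-- `B = y ^ 3 + x + x ^ 2`. -/
def grossB : Matrix (ZMod 12 × ZMod 6) (ZMod 12 × ZMod 6) (ZMod 2) :=
  shiftMatrix {(0, 3), (1, 0), (2, 0)}

/-- The `[[144, 12, 12]]` gross code: the bivariate bicycle code with `H_X = [A | B]` and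
`H_Z = [Bᵀ | Aᵀ]`. -/
def grossCode : CSSCode (fun _ => ZMod 12 × ZMod 6)
    ((ZMod 12 × ZMod 6) ⊕ (ZMod 12 × ZMod 6)) where
  H
    | .X => Matrix.fromCols grossA grossB
    | .Z => Matrix.fromCols grossB.transpose grossA.transpose
  comm := by
    have h : ∀ M : Matrix (ZMod 12 × ZMod 6) (ZMod 12 × ZMod 6) (ZMod 2), M + M = 0 := by
      intro M
      ext i j
      exact CharTwo.add_self_eq_zero _
    change Matrix.fromCols grossA grossB *
      (Matrix.fromCols grossB.transpose grossA.transpose).transpose = 0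
    rw [Matrix.transpose_fromCols, Matrix.fromCols_mul_fromRows, Matrix.transpose_transpose,
      Matrix.transpose_transpose, grossA, grossB, shiftMatrix_mul_comm, h]

end GrossCode

end SyndromeExtraction

/-!
In the experiment of basis `b`, consider errors of type `b.dual`, which the final measurements
detect. Let a CNOT of a check of type `b.dual` fail so that an error stays on the ancilla. It
spreads to the data qubits that the ancilla has yet to meet: a single fault causes this *hook
error*. As the circuit is non-interleaved, each round of the checks of type `b` comes either after
or before all CNOTs of the faulty round, so it sees the hook error entirely or not at all. The
same holds, for the same rounds, for a fault of any CNOT of the faulty round that only affects its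
data qubit. Hence such faults add up to an undetected logical error as soon as their data errors
add up to a logical operator `V`, and a hook error inside `V` saves all but one of its qubits. In
the gross code, any two data qubits of a check belong to a logical operator of weight 12. Taking
the last two data qubits that some ancilla meets leaves 10 single data errors and one hook error.
-/

namespace SyndromeExtraction

theorem exists_card_filter_lt_eq {α β : Type*} [LinearOrder β] {s : Finset α} {f : α → β}
    (hf : Set.InjOn f s) {n : ℕ} (hn : n < s.card) :
    ∃ p ∈ s, Finset.card {q ∈ s | f p < f q} = n := by
  classical
  induction n generalizing s with
  | zero =>
    obtain ⟨p, hp, hmax⟩ := s.exists_max_image f (Finset.card_pos.1 hn)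
    exact ⟨p, hp,
      Finset.card_eq_zero.2 (Finset.filter_eq_empty_iff.2 fun q hq => (hmax q hq).not_gt)⟩
  | succ n ih =>
    obtain ⟨a, ha, hmax⟩ := s.exists_max_image f (Finset.card_pos.1 (by omega))
    obtain ⟨p, hp, hpn⟩ := ih (s := s.erase a) (hf.mono (Finset.erase_subset a s))
      (by rw [Finset.card_erase_of_mem ha]; omega)
    obtain ⟨hpa, hps⟩ := Finset.mem_erase.1 hp
    have hlt : f p < f a := (hmax p hps).lt_of_ne (hf.ne hps ha hpa)
    refine ⟨p, hps, ?_⟩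
    rw [← Finset.insert_erase ha, Finset.filter_insert, if_pos hlt,
      Finset.card_insert_of_notMem (by simp), hpn]

/-- Members of a family which occur an even number of times cancel. -/
theorem exists_finset_sum_eq_sum_comp {ι α : Type*} [Fintype ι] (f : ι → α) :
    ∃ E : Finset α, E.card ≤ Fintype.card ι ∧
      ∀ φ : α → ZMod 2, ∑ a ∈ E, φ a = ∑ i, φ (f i) := by
  classical
  refine ⟨{a ∈ Finset.univ.image f | Odd (Finset.card {i | f i = a})},
    (Finset.card_filter_le _ _).trans Finset.card_image_le, fun φ => ?_⟩
  rw [Finset.sum_comp φ f, Finset.sum_filter]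
  refine Finset.sum_congr rfl fun a _ => ?_
  split_ifs with hodd
  · rw [nsmul_eq_mul, ZMod.natCast_eq_one_iff_odd.2 hodd, one_mul]
  · rw [nsmul_eq_mul, ZMod.natCast_eq_zero_iff_even.2 (Nat.not_odd_iff_even.1 hodd), zero_mul]

namespace Basis

theorem dual_dual (b : Basis) : b.dual.dual = b := by
  cases b <;> rfl

theorem dual_ne (b : Basis) : b.dual ≠ b := by
  cases b <;> decide

theorem eq_or_eq_dual (b b' : Basis) : b' = b ∨ b' = b.dual := by
  cases b <;> cases b' <;> decide

end Basis

section Propagation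

variable {V : Type*} {b : Basis} {u v : V}

/-- The CNOT between `u` and `v` which copies errors of type `b` from `u` to `v`: it treats `X` and
`Z` errors on the same footing. -/
def Gate.copy (b : Basis) (u v : V) : Gate V :=
  match b with
  | .X => .cnot u v
  | .Z => .cnot v u

theorem Gate.copy_ne_meas (b b' : Basis) (u v w : V) : Gate.copy b u v ≠ .meas b' w := by
  cases b <;> exact nofun

theorem Gate.isFault_copy {P : Pauli V} :
    (Gate.copy b u v).IsFault P ↔ P ≠ 0 ∧ ∀ b', Function.support (P b') ⊆ {u, v} := by
  cases b
  · rfl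
  · rw [Set.pair_comm]
    rfl

variable [Fintype V] {C : Circuit V}

open Classical in
theorem propagate_apply (L : Set (Gate V)) (P : Pauli V) (b : Basis) (v : V) :
    propagate L P b v = if ∃ b', Gate.prep b' v ∈ L then 0
      else P b v + ∑ u, if Gate.copy b u v ∈ L then P b u else 0 := by
  cases b <;> rfl

namespace Mechanism

open Classical in
theorem frame_succ (e : Mechanism C) (t : ℕ) (b : Basis) (v : V) :
    e.frame (t + 1) b v = (if ∃ b', Gate.prep b' v ∈ C t then 0
      else e.frame t b v + ∑ u, if Gate.copy b u v ∈ C t then e.frame t b u else 0) +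
        if t = e.time then e.error b v else 0 := by
  rw [frame, Pi.add_apply, Pi.add_apply, propagate_apply]
  split_ifs <;> rfl

theorem frame_eq_zero_of_error_eq_zero (e : Mechanism C) (he : e.error b = 0) (t : ℕ) :
    e.frame t b = 0 := by
  induction t with
  | zero => rfl
  | succ t ih =>
    funext v
    simp [frame_succ, ih, he]

theorem frame_eq_zero_of_not_copy (e : Mechanism C) (he : e.error b v = 0)
    (hcopy : ∀ t u, Gate.copy b u v ∉ C t) (t : ℕ) : e.frame t b v = 0 := by
  induction t with
  | zero => rfl
  | succ t ih => simp [frame_succ, ih, he, hcopy]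

open Classical in
/-- A preparation erases the past of `v`. -/
theorem frame_eq_of_prep (e : Mechanism C) {s t : ℕ} (hst : s < t)
    (hs : ∃ b', Gate.prep b' v ∈ C s) (ht : ∀ k ∈ Finset.Ico (s + 1) t, ∀ b', Gate.prep b' v ∉ C k)
    (b : Basis) :
    e.frame t b v =
      (∑ k ∈ Finset.Ico (s + 1) t, ∑ u, if Gate.copy b u v ∈ C k then e.frame k b u else 0) +
        if s ≤ e.time ∧ e.time < t then e.error b v else 0 := by
  induction t, hst using Nat.le_induction with
  | base =>
    rw [frame_succ, if_pos hs, Finset.Ico_self, Finset.sum_empty]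
    exact congrArg _ (if_congr (by omega) rfl rfl)
  | succ t hst ih =>
    have hnot : ¬∃ b', Gate.prep b' v ∈ C t := fun ⟨b', h⟩ =>
      ht t (Finset.mem_Ico.2 ⟨hst, t.lt_succ_self⟩) b' h
    have herror : ((if s ≤ e.time ∧ e.time < t then e.error b v else 0) +
        if t = e.time then e.error b v else 0) =
          if s ≤ e.time ∧ e.time < t + 1 then e.error b v else 0 := by
      by_cases h : t = e.time
      · rw [if_neg (by omega), if_pos h, if_pos (by omega), zero_add]
      · rw [if_neg h, add_zero]
        exact if_congr (by omega) rfl rfl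
    rw [frame_succ, if_neg hnot, ih fun k hk => ht k (Finset.Ico_subset_Ico_right t.le_succ hk),
      Finset.sum_Ico_succ_top hst, ← herror]
    ring

end Mechanism

end Propagation

section Codes

variable {R : Basis → Type*} {Q : Type*} [Fintype Q] {K : CSSCode R Q} {b : Basis}

theorem CSSCode.mem_logicals_of_dotProduct_ne_zero {v w : Q → ZMod 2}
    (hv : (K.H b).mulVec v = 0) (hw : (K.H b.dual).mulVec w = 0) (hwv : w ⬝ᵥ v ≠ 0) :
    w ∈ K.logicals b := by
  refine ⟨hw, fun hspan => hwv ?_⟩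
  clear hw hwv
  induction hspan using Submodule.span_induction with
  | mem _ h =>
    obtain ⟨j, rfl⟩ := h
    exact congrFun hv j
  | zero => exact zero_dotProduct v
  | add x y _ _ hx hy => rw [add_dotProduct, hx, hy, add_zero]
  | smul a x _ hx => rw [smul_dotProduct, hx, smul_zero]

theorem CSSCode.H_eq_zero_of_notMem_support {c : K.Check} {q : Q} (hq : q ∉ K.support c) :
    K.H c.1 c.2 q = 0 := by
  have h01 : ∀ x : ZMod 2, x ≠ 1 → x = 0 := by decide
  exact h01 _ hq

/-- The operator of the opposite type supported on `V` commutes with the checks of type `b`. -/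
def CSSCode.Commutes (K : CSSCode R Q) (b : Basis) (V : Finset Q) : Prop :=
  ∀ i, ∑ q ∈ V, K.H b i q = 0

theorem CSSCode.Commutes.mulVec_indicator {V : Finset Q} (hV : K.Commutes b V) :
    (K.H b).mulVec (Set.indicator V 1) = 0 := by
  classical
  funext i
  simpa [Matrix.mulVec, dotProduct, Set.indicator_apply] using hV i

end Codes

namespace SEC

variable {R : Basis → Type*} {Q : Type*} [Fintype Q] {K : CSSCode R Q} {S : SEC K}
  {c c' : K.Check} {q : Q} {r r' m t : ℕ} {b b' : Basis}

theorem prep_lt_cnotTime (hq : q ∈ K.support c) : S.start r + S.prep c < S.cnotTime c q r :=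
  Nat.add_lt_add_left (S.prep_lt_cnot c q hq) _

theorem cnotTime_lt_meas (hq : q ∈ K.support c) : S.cnotTime c q r < S.start r + S.meas c :=
  Nat.add_lt_add_left (S.cnot_lt_meas c q hq) _

theorem meas_lt_prep_of_lt (h : r < r') : S.start r + S.meas c < S.start r' + S.prep c := by
  induction r', h using Nat.le_induction with
  | base => exact S.meas_lt_prep c r
  | succ n _ ih =>
    have := S.meas_lt_prep c n
    have := S.prep_lt_meas c
    omega

theorem round_unique (h : t ∈ Set.Icc (S.start r + S.prep c) (S.start r + S.meas c))
    (h' : t ∈ Set.Icc (S.start r' + S.prep c) (S.start r' + S.meas c)) : r = r' := by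
  by_contra hne
  rcases Nat.lt_or_gt_of_ne hne with hlt | hlt
  · exact (h.2.trans_lt (meas_lt_prep_of_lt hlt)).not_ge h'.1
  · exact (h'.2.trans_lt (meas_lt_prep_of_lt hlt)).not_ge h.1

theorem Precedes.cnotTime_lt (h : S.Precedes b r r') (hc : c.1 = b) (hc' : c'.1 = b.dual)
    (hq : q ∈ K.support c) (hq' : q ∈ K.support c') : S.cnotTime c q r < S.cnotTime c' q r' := by
  obtain ⟨_, i⟩ := c
  obtain ⟨_, j⟩ := c'
  subst hc hc'
  exact h i j q hq hq'

section Gates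

variable [∀ b, Fintype (R b)]

theorem cnotTime_lt_finish (hr : r < m) (hq : q ∈ K.support c) :
    S.cnotTime c q r + 1 < S.finish m := by
  have hround : S.start r + S.meas c ≤
      (Finset.range m).sup fun r => Finset.univ.sup fun c => S.start r + S.meas c :=
    (Finset.le_sup (f := fun c => S.start r + S.meas c) (Finset.mem_univ c)).trans
      (Finset.le_sup (f := fun r => Finset.univ.sup fun c => S.start r + S.meas c)
        (Finset.mem_range.2 hr))
  have := cnotTime_lt_meas (S := S) (r := r) hq
  unfold finish
  omega

theorem prep_data_mem_iff :
    Gate.prep b' (.inl q) ∈ S.memoryCircuit b m t ↔ t = 0 ∧ b' = b := by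
  constructor
  · rintro (h | ⟨_, ⟨⟩, _⟩)
    cases h
    exact ⟨rfl, rfl⟩
  · rintro ⟨rfl, rfl⟩
    exact .inl (.dataPrep q)

theorem prep_ancilla_mem_iff :
    Gate.prep b' (.inr c) ∈ S.memoryCircuit b m t ↔
      b' = c.1 ∧ ∃ r < m, t = S.start r + S.prep c + 1 := by
  constructor
  · rintro (h | ⟨_, ⟨⟩, _⟩)
    cases h with
    | ancillaPrep c r hr => exact ⟨rfl, r, hr, rfl⟩
  · rintro ⟨rfl, r, hr, rfl⟩
    exact .inl (.ancillaPrep c r hr)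

theorem copy_ancilla_data_mem_iff :
    Gate.copy b' (.inr c) (.inl q) ∈ S.memoryCircuit b m t ↔
      c.1 = b' ∧ q ∈ K.support c ∧ ∃ r < m, t = S.cnotTime c q r + 1 := by
  constructor
  · cases b' <;> rintro (h | ⟨_, ⟨⟩, _⟩)
    · cases h with
      | cnotX i q r hr hq => exact ⟨rfl, hq, r, hr, rfl⟩
    · cases h with
      | cnotZ j q r hr hq => exact ⟨rfl, hq, r, hr, rfl⟩
  · rintro ⟨rfl, hq, r, hr, rfl⟩
    obtain ⟨_ | _, i⟩ := c
    · exact .inl (.cnotX i q r hr hq)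
    · exact .inl (.cnotZ i q r hr hq)

theorem copy_data_ancilla_mem_iff :
    Gate.copy b' (.inl q) (.inr c) ∈ S.memoryCircuit b m t ↔
      c.1 = b'.dual ∧ q ∈ K.support c ∧ ∃ r < m, t = S.cnotTime c q r + 1 := by
  have hreverse : (Gate.copy b' (.inl q) (.inr c) : Gate K.Qubit) =
      .copy b'.dual (.inr c) (.inl q) := by
    cases b' <;> rfl
  rw [hreverse, copy_ancilla_data_mem_iff]

theorem not_copy_data_data_mem (q q' : Q) :
    Gate.copy b' (.inl q) (.inl q') ∉ S.memoryCircuit b m t := by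
  cases b' <;> rintro (h | ⟨_, ⟨⟩, _⟩) <;> cases h

theorem not_copy_ancilla_ancilla_mem (c c' : K.Check) :
    Gate.copy b' (.inr c) (.inr c') ∉ S.memoryCircuit b m t := by
  cases b' <;> rintro (h | ⟨_, ⟨⟩, _⟩) <;> cases h

theorem not_copy_self_ancilla_mem (c : K.Check) (u : K.Qubit) :
    Gate.copy c.1 u (.inr c) ∉ S.memoryCircuit b m t := by
  rcases u with q | c'
  · exact fun h => c.1.dual_ne (copy_data_ancilla_mem_iff.1 h).1.symm
  · exact not_copy_ancilla_ancilla_mem c' c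

theorem not_prep_ancilla_mem
    (ht : t ∈ Set.Ioc (S.start r + S.prep c + 1) (S.start r + S.meas c + 1)) :
    Gate.prep b' (.inr c) ∉ S.memoryCircuit b m t := by
  intro h
  obtain ⟨-, r', -, rfl⟩ := prep_ancilla_mem_iff.1 h
  have := S.prep_lt_meas c
  rw [Set.mem_Ioc] at ht
  obtain rfl : r = r' := round_unique (S := S) (c := c) (t := S.start r' + S.prep c)
    ⟨by omega, by omega⟩ ⟨le_rfl, by omega⟩
  omega

end Gates

section DataErrors

variable [∀ b, Fintype (R b)] {e : Mechanism (S.memoryCircuit b m)}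

theorem frame_ancilla_meas (he : e.error c.1.dual (.inr c) = 0) (hr : r < m) :
    e.frame (S.start r + S.meas c + 1) c.1.dual (.inr c) =
      ∑ q, K.H c.1 c.2 q * e.frame (S.cnotTime c q r + 1) c.1.dual (.inl q) := by
  classical
  have hprep := S.prep_lt_meas c
  rw [e.frame_eq_of_prep (s := S.start r + S.prep c + 1) (by omega)
    ⟨c.1, prep_ancilla_mem_iff.2 ⟨rfl, r, hr, rfl⟩⟩
    fun k hk b' => not_prep_ancilla_mem (by rw [Finset.mem_Ico] at hk; exact ⟨hk.1, hk.2.le⟩),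
    he, ite_self, add_zero, Finset.sum_comm, Fintype.sum_sum_type]
  simp only [not_copy_ancilla_ancilla_mem, if_false, Finset.sum_const_zero, add_zero,
    copy_data_ancilla_mem_iff, c.1.dual_dual, true_and]
  refine Finset.sum_congr rfl fun q _ => ?_
  by_cases hq : q ∈ K.support c
  · have hlt := prep_lt_cnotTime (S := S) (r := r) hq
    have hlt' := cnotTime_lt_meas (S := S) (r := r) hq
    rw [show K.H c.1 c.2 q = 1 from hq, one_mul, Finset.sum_eq_single (S.cnotTime c q r + 1),
      if_pos ⟨hq, r, hr, rfl⟩]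
    · rintro k hk hne
      refine if_neg fun ⟨_, r', _, hk'⟩ => hne ?_
      rw [Finset.mem_Ico] at hk
      obtain rfl : r = r' := round_unique (S := S) (c := c) (t := S.cnotTime c q r')
        ⟨by omega, by omega⟩ ⟨(prep_lt_cnotTime hq).le, (cnotTime_lt_meas hq).le⟩
      exact hk'
    · exact fun h => (h (Finset.mem_Ico.2 ⟨by omega, by omega⟩)).elim
  · rw [CSSCode.H_eq_zero_of_notMem_support hq, zero_mul]
    exact Finset.sum_eq_zero fun k _ => if_neg fun h => hq h.1

/-- The mechanism `e` is indistinguishable from the error `d` on the data qubits, occurring between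
two rounds: the checks of the type of the experiment see all of `d` in the rounds belonging to `A`
and nothing in the others. -/
structure ActsAsDataError (e : Mechanism (S.memoryCircuit b m)) (A : Set ℕ) (d : Q → ZMod 2) :
    Prop where
  dataFlip_eq (q : Q) : dataFlip e q = d q
  outcomeFlip_eq_zero {c : K.Check} (hc : c.1 = b.dual) (t : ℕ) :
    e.outcomeFlip t c.1 (.inr c) = 0
  outcomeFlip_of_mem {c : K.Check} (hc : c.1 = b) {r : ℕ} (hr : r < m) (hA : r ∈ A) :
    e.outcomeFlip (S.start r + S.meas c + 1) c.1 (.inr c) = K.H c.1 c.2 ⬝ᵥ d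
  outcomeFlip_of_notMem {c : K.Check} (hc : c.1 = b) {r : ℕ} (hr : r < m) (hA : r ∉ A) :
    e.outcomeFlip (S.start r + S.meas c + 1) c.1 (.inr c) = 0

variable {ι : Type*} [Fintype ι] {f : ι → Mechanism (S.memoryCircuit b m)} {A : Set ℕ}
  {d : ι → Q → ZMod 2}

theorem ActsAsDataError.syndromeFlip_eq_zero {d : Q → ZMod 2} (h : ActsAsDataError e A d)
    (hc : c.1 = b.dual) {k : ℕ} (hk : k ≤ m) : syndromeFlip e c k = 0 := by
  cases k with
  | zero => rfl
  | succ k => rw [syndromeFlip, if_pos (by omega), h.outcomeFlip_eq_zero hc]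

theorem sum_syndromeFlip_eq_zero (h : ∀ i, ActsAsDataError (f i) A (d i))
    (hd : (K.H b).mulVec (∑ i, d i) = 0) (hc : c.1 = b) (k : ℕ) :
    ∑ i, syndromeFlip (f i) c k = 0 := by
  have hsum : ∑ i, K.H c.1 c.2 ⬝ᵥ d i = 0 := by
    obtain ⟨_, j⟩ := c
    subst hc
    rw [← dotProduct_sum]
    exact congrFun hd j
  cases k with
  | zero => exact Finset.sum_const_zero
  | succ k =>
    simp only [syndromeFlip]
    by_cases hk : k < m
    · by_cases hA : k ∈ A
      · simpa only [if_pos hk, (h _).outcomeFlip_of_mem hc hk hA] using hsum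
      · simp only [if_pos hk, (h _).outcomeFlip_of_notMem hc hk hA, Finset.sum_const_zero]
    · simpa only [if_neg hk, (h _).dataFlip_eq] using! hsum

theorem basisDistance_le_card (h : ∀ i, ActsAsDataError (f i) A (d i))
    (hd : (K.H b).mulVec (∑ i, d i) = 0) {w : Q → ZMod 2} (hw : (K.H b.dual).mulVec w = 0)
    (hwd : w ⬝ᵥ ∑ i, d i ≠ 0) : S.basisDistance b m ≤ Fintype.card ι := by
  obtain ⟨E, hcard, hE⟩ := exists_finset_sum_eq_sum_comp f
  have hlogical := K.mem_logicals_of_dotProduct_ne_zero hd hw hwd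
  refine (iInf₂_le E ⟨fun c k hk => ?_, w, hlogical, ?_⟩).trans (Nat.cast_le.2 hcard)
  · rw [hE]
    rcases b.eq_or_eq_dual c.1 with hc | hc
    · simp only [detectorFlip, Finset.sum_add_distrib, sum_syndromeFlip_eq_zero h hd hc, add_zero]
    · rw [IsDetector, if_neg (hc.trans_ne b.dual_ne)] at hk
      refine Finset.sum_eq_zero fun i _ => ?_
      rw [detectorFlip, (h i).syndromeFlip_eq_zero hc (by omega),
        (h i).syndromeFlip_eq_zero hc (by omega), add_zero]
  · rw [hE]
    rw [dotProduct_sum] at hwd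
    simpa only [observableFlip, (h _).dataFlip_eq] using! hwd

end DataErrors

section CNOTFaults

variable {p : Q} {α β : ZMod 2}

open Classical in
/-- The data qubits on which the ancilla of `c` acts after its CNOT with `p`: an error on the
ancilla after that CNOT spreads to exactly these. -/
noncomputable def hook (S : SEC K) (c : K.Check) (p : Q) : Finset Q :=
  {q | q ∈ K.support c ∧ S.cnot c p < S.cnot c q}

open Classical in
/-- The data error which remains in the end when `S.cnotFault` leaves the errors `α` and `β`. -/
noncomputable def residualError (S : SEC K) (c : K.Check) (p : Q) (α β : ZMod 2) : Q → ZMod 2 :=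
  Pi.single p β + fun q => if q ∈ S.hook c p then α else 0

theorem residualError_eq_zero (hp : p ∈ K.support c) (hq : q ∉ K.support c) :
    S.residualError c p α β q = 0 := by
  have hqp : q ≠ p := fun h => hq (h ▸ hp)
  simp [residualError, hook, hq, hqp]

variable [∀ b, Fintype (R b)]

open Classical in
/-- The failure of the CNOT between the ancilla of `c` and the data qubit `p` in round `r` which
leaves the errors `α` on the ancilla and `β` on the data qubit, both of the type which spreads from
the ancilla to the data. -/
noncomputable def cnotFault (S : SEC K) (b : Basis) (hr : r < m) (hp : p ∈ K.support c)
    (hαβ : α ≠ 0 ∨ β ≠ 0) : Mechanism (S.memoryCircuit b m) where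
  time := S.cnotTime c p r + 1
  gate := .copy c.1 (.inr c) (.inl p)
  mem := copy_ancilla_data_mem_iff.2 ⟨rfl, hp, r, hr, rfl⟩
  error := Pi.single c.1 (Sum.elim (Pi.single p β) (Pi.single c α))
  isFault := by
    refine Gate.isFault_copy.2 ⟨fun h => ?_, fun b' => ?_⟩
    · have hc := congrFun h c.1
      rw [Pi.single_eq_same] at hc
      rcases hαβ with hα | hβ
      · exact hα (by simpa using congrFun hc (.inr c))
      · exact hβ (by simpa using congrFun hc (.inl p))
    · obtain rfl | hb' := eq_or_ne b' c.1
      · rw [Pi.single_eq_same]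
        rintro (q | c') hv <;> simp_all [Pi.single_apply]
      · simp [Pi.single_eq_of_ne hb']

variable {hr : r < m} {hp : p ∈ K.support c} {hαβ : α ≠ 0 ∨ β ≠ 0}

theorem cnotFault_frame_other_ancilla (hc' : c' ≠ c) (hcc' : c'.1 = c.1) (t : ℕ) :
    (S.cnotFault b hr hp hαβ).frame t c.1 (.inr c') = 0 := by
  refine Mechanism.frame_eq_zero_of_not_copy _ ?_
    (fun _ u => hcc' ▸ not_copy_self_ancilla_mem c' u) t
  simp [cnotFault, hc']

open Classical in
theorem cnotFault_frame_ancilla (hr' : r' < m) (hq : q ∈ K.support c) :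
    (S.cnotFault b hr hp hαβ).frame (S.cnotTime c q r' + 1) c.1 (.inr c) =
      if r' = r ∧ S.cnot c p < S.cnot c q then α else 0 := by
  have hprep := prep_lt_cnotTime (S := S) (r := r') hq
  have hmeas := cnotTime_lt_meas (S := S) (r := r') hq
  rw [Mechanism.frame_eq_of_prep _ (s := S.start r' + S.prep c + 1) (by omega)
    ⟨c.1, prep_ancilla_mem_iff.2 ⟨rfl, r', hr', rfl⟩⟩
    fun k hk b' => not_prep_ancilla_mem (by
      rw [Finset.mem_Ico] at hk; exact ⟨hk.1, by omega⟩)]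
  simp only [not_copy_self_ancilla_mem, if_false, Finset.sum_const_zero, zero_add]
  refine if_congr ⟨fun ⟨hle, hlt⟩ => ?_, fun ⟨h, hlt⟩ => ?_⟩ (by simp [cnotFault]) rfl
  · simp only [cnotFault] at hle hlt
    obtain rfl : r' = r := round_unique (S := S) (c := c) (t := S.cnotTime c p r)
      ⟨by omega, by omega⟩ ⟨(prep_lt_cnotTime hp).le, (cnotTime_lt_meas hp).le⟩
    exact ⟨rfl, by simp only [cnotTime] at hlt; omega⟩
  · subst h
    have := prep_lt_cnotTime (S := S) (r := r') hp
    simp only [cnotFault]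
    exact ⟨by omega, by simp only [cnotTime]; omega⟩

open Classical in
theorem sum_cnotFault_frame_of_copy (k : ℕ) (q : Q) :
    (∑ u, if Gate.copy c.1 u (.inl q) ∈ S.memoryCircuit b m k then
      (S.cnotFault b hr hp hαβ).frame k c.1 u else 0) =
        if k = S.cnotTime c q r + 1 then (if q ∈ S.hook c p then α else 0) else 0 := by
  have hother (c' : K.Check) (hc' : c' ≠ c) :
      (if Gate.copy c.1 (.inr c') (.inl q) ∈ S.memoryCircuit b m k then
        (S.cnotFault b hr hp hαβ).frame k c.1 (.inr c') else 0) = 0 :=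
    ite_eq_right_iff.2 fun h =>
      cnotFault_frame_other_ancilla hc' (copy_ancilla_data_mem_iff.1 h).1 k
  simp only [Fintype.sum_sum_type, not_copy_data_data_mem, if_false, Finset.sum_const_zero,
    zero_add]
  rw [Fintype.sum_eq_single c hother, ← ite_and]
  by_cases hcopy : Gate.copy c.1 (.inr c) (.inl q) ∈ S.memoryCircuit b m k
  · obtain ⟨-, hq, r', hr', rfl⟩ := copy_ancilla_data_mem_iff.1 hcopy
    have hround : r' = r ↔ S.cnotTime c q r' + 1 = S.cnotTime c q r + 1 :=
      ⟨fun h => h ▸ rfl, fun h => (S.data_inj c c q r' r hq hq (Nat.succ.inj h)).2⟩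
    rw [if_pos hcopy, cnotFault_frame_ancilla hr' hq]
    exact if_congr (and_congr hround (by simp [hook, hq])) rfl rfl
  · rw [if_neg hcopy, if_neg]
    rintro ⟨rfl, hq⟩
    exact hcopy (copy_ancilla_data_mem_iff.2 ⟨rfl, (Finset.mem_filter.1 hq).2.1, r, hr, rfl⟩)

open Classical in
theorem cnotFault_frame_data (ht : 0 < t) (q : Q) :
    (S.cnotFault b hr hp hαβ).frame t c.1 (.inl q) =
      if S.cnotTime c q r + 1 < t then S.residualError c p α β q else 0 := by
  have hprep : ∀ k ∈ Finset.Ico (0 + 1) t, ∀ b', Gate.prep b' (.inl q) ∉ S.memoryCircuit b m k := by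
    intro k hk b' h
    exact (Nat.pos_iff_ne_zero.1 (Finset.mem_Ico.1 hk).1) (prep_data_mem_iff.1 h).1
  have herror : (if 0 ≤ (S.cnotFault b hr hp hαβ).time ∧ (S.cnotFault b hr hp hαβ).time < t then
      (S.cnotFault b hr hp hαβ).error c.1 (.inl q) else 0) =
        if S.cnotTime c q r + 1 < t then (Pi.single p β : Q → ZMod 2) q else 0 := by
    obtain rfl | hqp := eq_or_ne q p
    · simp [cnotFault]
    · simp [cnotFault, hqp]
  rw [Mechanism.frame_eq_of_prep _ ht ⟨b, prep_data_mem_iff.2 ⟨rfl, rfl⟩⟩ hprep, herror]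
  simp only [sum_cnotFault_frame_of_copy, Finset.sum_ite_eq', Finset.mem_Ico, residualError,
    Pi.add_apply]
  by_cases h : S.cnotTime c q r + 1 < t
  · rw [if_pos ⟨by omega, h⟩, if_pos h, if_pos h, add_comm]
  · rw [if_neg (h ·.2), if_neg h, if_neg h, add_zero]

theorem cnotFault_outcomeFlip (t : ℕ) (b' : Basis) (v : K.Qubit) :
    (S.cnotFault b hr hp hαβ).outcomeFlip t b' v =
      (S.cnotFault b hr hp hαβ).frame t b'.dual v := by
  rw [Mechanism.outcomeFlip, if_neg fun h => Gate.copy_ne_meas _ _ _ _ _ h.2, add_zero]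

open Classical in
theorem cnotFault_outcomeFlip_ancilla (hc' : c'.1.dual = c.1) (hr' : r' < m) :
    (S.cnotFault b hr hp hαβ).outcomeFlip (S.start r' + S.meas c' + 1) c'.1 (.inr c') =
      ∑ q, K.H c'.1 c'.2 q * if S.cnotTime c q r < S.cnotTime c' q r' then
        S.residualError c p α β q else 0 := by
  have hne : c' ≠ c := fun h => c'.1.dual_ne (by rw [hc', h])
  rw [cnotFault_outcomeFlip, frame_ancilla_meas (by simp [cnotFault, hc', hne]) hr', hc']
  simp only [cnotFault_frame_data (Nat.add_one_pos _), Nat.add_lt_add_iff_right]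

theorem cnotFault_actsAsDataError (hc : c.1 = b.dual)
    (hS : ∀ r' < m, S.Precedes b.dual r r' ∨ S.Precedes b r' r) :
    ActsAsDataError (S.cnotFault b hr hp hαβ) {r' | S.Precedes b.dual r r'}
      (S.residualError c p α β) := by
  classical
  refine ⟨fun q => ?_, fun {c'} hc' t => ?_, fun {c'} hc' r' hr' hA => ?_,
    fun {c'} hc' r' hr' hA => ?_⟩
  · rw [dataFlip, cnotFault_outcomeFlip, ← hc, cnotFault_frame_data (by simp [finish])]
    by_cases hq : q ∈ K.support c
    · exact if_pos (cnotTime_lt_finish hr hq)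
    · rw [residualError_eq_zero hp hq, ite_self]
  · have herror : (S.cnotFault b hr hp hαβ).error b = 0 :=
      Pi.single_eq_of_ne (hc.trans_ne b.dual_ne).symm _
    rw [cnotFault_outcomeFlip, hc', b.dual_dual, Mechanism.frame_eq_zero_of_error_eq_zero _ herror,
      Pi.zero_apply]
  all_goals
    rw [cnotFault_outcomeFlip_ancilla (by rw [hc, hc']) hr']
  · refine Finset.sum_congr rfl fun q _ => ?_
    by_cases hq : q ∈ K.support c
    · by_cases hq' : q ∈ K.support c'
      · rw [if_pos (Precedes.cnotTime_lt hA hc (by rw [b.dual_dual, hc']) hq hq')]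
      · rw [K.H_eq_zero_of_notMem_support hq', zero_mul, zero_mul]
    · rw [residualError_eq_zero hp hq, ite_self]
  · refine Finset.sum_eq_zero fun q _ => ?_
    by_cases hq : q ∈ K.support c
    · by_cases hq' : q ∈ K.support c'
      · rw [if_neg (((hS r' hr').resolve_left hA).cnotTime_lt hc' hc hq' hq).not_gt, mul_zero]
      · rw [K.H_eq_zero_of_notMem_support hq', zero_mul]
    · rw [residualError_eq_zero hp hq, ite_self, mul_zero]

end CNOTFaults

section HookErrors

variable [DecidableEq Q] {p : Q} {V W : Finset Q}

theorem residualError_zero_one : S.residualError c p 0 1 = Pi.single p 1 := by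
  funext q
  simp [residualError, Pi.single_apply]

theorem residualError_add_sum_residualError (hhook : S.hook c p ⊆ V)
    (f : ↥(V \ S.hook c p) → K.Check) :
    S.residualError c p 1 0 + ∑ q, S.residualError (f q) q 0 1 = Set.indicator V 1 := by
  funext q
  have hrest : ∑ q', S.residualError (f q') q' 0 1 q = if q ∈ V \ S.hook c p then 1 else 0 := by
    simp only [residualError_zero_one]
    rw [Finset.sum_coe_sort (V \ S.hook c p) fun q' => (Pi.single q' 1 : Q → ZMod 2) q]
    simp [Pi.single_apply]
  rw [Pi.add_apply, Finset.sum_apply, hrest]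
  by_cases hq : q ∈ S.hook c p
  · simp [residualError, hq, hhook hq]
  · simp [residualError, hq, Set.indicator_apply]

/-- The hook error is completed to `V` by faults of CNOTs of the same round: they are seen in the
same rounds as the hook error. -/
theorem basisDistance_le_card_sub_card_hook [∀ b, Fintype (R b)] (hr : r < m)
    (hS : ∀ r' < m, S.Precedes b.dual r r' ∨ S.Precedes b r' r) (hc : c.1 = b.dual)
    (hp : p ∈ K.support c) (hhook : S.hook c p ⊆ V)
    (hcover : ∀ q ∈ V, ∃ i : R b.dual, q ∈ K.support ⟨b.dual, i⟩) (hV : K.Commutes b V)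
    (hW : K.Commutes b.dual W) (hVW : Odd (V ∩ W).card) :
    S.basisDistance b m ≤ (V.card - (S.hook c p).card + 1 : ℕ) := by
  choose i hi using fun q : ↥(V \ S.hook c p) => hcover q (Finset.mem_sdiff.1 q.2).1
  let f : Option ↥(V \ S.hook c p) → Mechanism (S.memoryCircuit b m)
    | none => S.cnotFault b hr hp (.inl one_ne_zero : (1 : ZMod 2) ≠ 0 ∨ (0 : ZMod 2) ≠ 0)
    | some q => S.cnotFault b hr (hi q) (.inr one_ne_zero : (0 : ZMod 2) ≠ 0 ∨ (1 : ZMod 2) ≠ 0)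
  let d : Option ↥(V \ S.hook c p) → Q → ZMod 2
    | none => S.residualError c p 1 0
    | some q => S.residualError ⟨b.dual, i q⟩ q 0 1
  have hf : ∀ o, ActsAsDataError (f o) {r' | S.Precedes b.dual r r'} (d o)
    | none => cnotFault_actsAsDataError hc hS
    | some q => cnotFault_actsAsDataError rfl hS
  have hd : ∑ o, d o = Set.indicator V 1 := by
    rw [Fintype.sum_option]
    exact residualError_add_sum_residualError hhook fun q => ⟨b.dual, i q⟩
  have hcard : Fintype.card (Option ↥(V \ S.hook c p)) = V.card - (S.hook c p).card + 1 := by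
    rw [Fintype.card_option, Fintype.card_coe, Finset.card_sdiff_of_subset hhook]
  rw [← hcard]
  refine basisDistance_le_card hf (hd ▸ hV.mulVec_indicator) hW.mulVec_indicator ?_
  have hoverlap : Set.indicator (W : Set Q) 1 ⬝ᵥ Set.indicator (V : Set Q) 1 =
      ((V ∩ W).card : ZMod 2) := by
    simp [dotProduct, Set.indicator_apply, Finset.inter_comm]
  rw [hd, hoverlap, ZMod.natCast_eq_one_iff_odd.2 hVW]
  exact one_ne_zero

end HookErrors

end SEC

section GrossLogicals

open scoped Pointwise

/-- The left blocks of three operators on the gross code, see `grossLogical`. -/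
def grossLogicalLeft : Fin 3 → Finset (ZMod 12 × ZMod 6) :=
  ![{(0, 0), (2, 2), (4, 4), (6, 0), (8, 2), (10, 4)},
    {(0, 0), (0, 1), (1, 0), (1, 2), (2, 0), (2, 4), (3, 1)},
    {(0, 3), (1, 5), (4, 4), (5, 5), (7, 2)}]

/-- The right blocks of three operators on the gross code, see `grossLogical`. -/
def grossLogicalRight : Fin 3 → Finset (ZMod 12 × ZMod 6) :=
  ![{(0, 2), (2, 4), (4, 0), (6, 2), (8, 4), (10, 0)},
    {(0, 2), (1, 0), (1, 1), (1, 4), (2, 1)},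
    {(0, 5), (1, 1), (2, 2), (2, 3), (5, 2), (6, 3), (9, 1)}]

/-- The supports of three logical operators of type `b` and weight 12, found by computer search so
that their translates cover all pairs of data qubits in a check. Exchanging the two blocks and
negating the group elements turns those of type `X` into those of type `Z`. -/
def grossLogical : Basis → Fin 3 → Finset ((ZMod 12 × ZMod 6) ⊕ (ZMod 12 × ZMod 6))
  | .X, k => (grossLogicalLeft k).disjSum (grossLogicalRight k)
  | .Z, k => (-grossLogicalRight k).disjSum (-grossLogicalLeft k)

/-- The support of the check `0` of type `b`, of which those of the other checks are translates. -/
def grossSupport (b : Basis) : Finset ((ZMod 12 × ZMod 6) ⊕ (ZMod 12 × ZMod 6)) :=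
  {q | grossCode.H b 0 q = 1}

variable {b b' : Basis} {V T : Finset ((ZMod 12 × ZMod 6) ⊕ (ZMod 12 × ZMod 6))}

theorem grossCode_H_vadd (b : Basis) (g i : ZMod 12 × ZMod 6)
    (q : (ZMod 12 × ZMod 6) ⊕ (ZMod 12 × ZMod 6)) :
    grossCode.H b (g + i) (g +ᵥ q) = grossCode.H b i q := by
  rcases b with _ | _ <;> rcases q with q | q <;>
    simp [grossCode, grossA, grossB, shiftMatrix]

theorem CSSCode.Commutes.vadd (hV : grossCode.Commutes b V) (g : ZMod 12 × ZMod 6) :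
    grossCode.Commutes b (g +ᵥ V) := by
  intro i
  rw [← Finset.image_vadd, Finset.sum_image (AddAction.injective g).injOn, ← hV (-g + i)]
  refine Finset.sum_congr rfl fun q _ => ?_
  rw [← grossCode_H_vadd b g (-g + i), add_neg_cancel_left]

theorem exists_mem_support_grossCode (b : Basis) (q : (ZMod 12 × ZMod 6) ⊕ (ZMod 12 × ZMod 6)) :
    ∃ i, q ∈ grossCode.support ⟨b, i⟩ := by
  obtain ⟨g, q₀, rfl, hq₀⟩ :
      ∃ (g : ZMod 12 × ZMod 6) (q₀ : (ZMod 12 × ZMod 6) ⊕ (ZMod 12 × ZMod 6)),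
        g +ᵥ q₀ = q ∧ (q₀ = .inl 0 ∨ q₀ = .inr 0) := by
    rcases q with g | g
    · exact ⟨g, .inl 0, by simp, .inl rfl⟩
    · exact ⟨g, .inr 0, by simp, .inr rfl⟩
  obtain ⟨i, hi⟩ : ∃ i, grossCode.H b i q₀ = 1 := by
    clear g
    revert b q₀
    decide +kernel
  exact ⟨g + i, (grossCode_H_vadd b g i q₀).trans hi⟩

theorem coe_grossSupport (b : Basis) : (grossSupport b : Set _) = grossCode.support ⟨b, 0⟩ := by
  ext q
  simp [grossSupport, CSSCode.support]

theorem card_grossSupport (b : Basis) : (grossSupport b).card = 6 := by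
  revert b
  decide +kernel

theorem card_grossLogical (b : Basis) (k : Fin 3) : (grossLogical b k).card = 12 := by
  revert b k
  decide +kernel

theorem commutes_grossLogical (h : b ≠ b') (k : Fin 3) :
    grossCode.Commutes b' (grossLogical b k) := by
  unfold CSSCode.Commutes
  revert b b' k
  decide +kernel

theorem exists_odd_card_grossLogical_inter (h : b ≠ b') (k : Fin 3) :
    ∃ k', Odd (grossLogical b k ∩ grossLogical b' k').card := by
  revert b b' k
  decide +kernel

theorem exists_vadd_mem_grossLogical (b : Basis) :
    ∀ a ∈ grossSupport b, ∀ a' ∈ grossSupport b,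
      ∃ k, ∃ g : ZMod 12 × ZMod 6, g +ᵥ a ∈ grossLogical b k ∧ g +ᵥ a' ∈ grossLogical b k := by
  revert b
  decide +kernel

theorem exists_logical_superset (h : b ≠ b') (hT : T ⊆ grossSupport b) (hcard : T.card = 2) :
    ∃ V W, T ⊆ V ∧ V.card = 12 ∧ grossCode.Commutes b' V ∧ grossCode.Commutes b W ∧
      Odd (V ∩ W).card := by
  obtain ⟨a, a', -, rfl⟩ := Finset.card_eq_two.1 hcard
  obtain ⟨ha, ha'⟩ := Finset.insert_subset_iff.1 hT
  obtain ⟨k, g, hka, hka'⟩ :=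
    exists_vadd_mem_grossLogical b a ha a' (Finset.singleton_subset_iff.1 ha')
  obtain ⟨k', hodd⟩ := exists_odd_card_grossLogical_inter h k
  refine ⟨-g +ᵥ grossLogical b k, -g +ᵥ grossLogical b' k', ?_, ?_,
    (commutes_grossLogical h k).vadd _, (commutes_grossLogical h.symm k').vadd _, ?_⟩
  · rw [Finset.insert_subset_iff, Finset.singleton_subset_iff]
    exact ⟨Finset.mem_neg_vadd_finset_iff.2 hka, Finset.mem_neg_vadd_finset_iff.2 hka'⟩
  · rw [Finset.card_vadd_finset, card_grossLogical]
  · rwa [← Finset.vadd_finset_inter, Finset.card_vadd_finset]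

end GrossLogicals

end SyndromeExtraction

open SyndromeExtraction in
theorem mainTheorem2_general (S : SEC grossCode) {b : Basis} {r m : ℕ} (hr : r < m)
    (hS : ∀ r' < m, S.Precedes b.dual r r' ∨ S.Precedes b r' r) : S.basisDistance b m ≤ 11 := by
  have hsupport := coe_grossSupport b.dual
  obtain ⟨p, hp, hcard⟩ := exists_card_filter_lt_eq (s := grossSupport b.dual)
    (f := S.cnot ⟨b.dual, 0⟩) (n := 2) (hsupport ▸ S.ancilla_inj _) (by simp [card_grossSupport])
  have hhook : S.hook ⟨b.dual, 0⟩ p =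
      {q ∈ grossSupport b.dual | S.cnot ⟨b.dual, 0⟩ p < S.cnot ⟨b.dual, 0⟩ q} := by
    ext q
    simp [SEC.hook, ← hsupport]
  obtain ⟨V, W, hTV, hVcard, hV, hW, hVW⟩ :=
    exists_logical_superset b.dual_ne (Finset.filter_subset _ _) hcard
  have hbound := SEC.basisDistance_le_card_sub_card_hook hr hS (c := ⟨b.dual, 0⟩) rfl
    (hsupport ▸ hp) (hhook ▸ hTV) (fun q _ => exists_mem_support_grossCode _ q) hV hW hVW
  rwa [hhook, hcard, hVcard] at hbound

theorem mainTheorem2 (S : SyndromeExtraction.SEC SyndromeExtraction.grossCode)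
    (hS : S.NonInterleaved) (m : ℕ) (hm : 1 ≤ m) : S.circuitDistance m ≤ 11 :=
  (min_le_right _ _).trans (mainTheorem2_general S (b := .Z) hm fun r' _ => hS 0 r')
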